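/- Let $K$ be a field, let $k>2$ and let $n_1,\dots,n_k$ be positive integers. Let $L=L_k(n_1,\dots,n_k)$ be the crystal lattice, that is, the finite lattice with elements $s$, $x_{i,j}$ ($1\le i\le k$, $1\le j\le n_i$) and $t$, ordered by $s<x_{i,1}<\cdots<x_{i,n_i}<t$ for $1\le i\le k$, where elements of different chains are incomparable. Let $R=K[L]$ be the polynomial ring over $K$ whose variables are the elements of $L$, let $$I_L=\bigl(ab-(a\vee b)(a\wedge b) : a,b\in L\bigr)\subset R$$ be the join-meet ideal of $L$, and let $\mathrm{in}_\prec(I_L)$ be its initial ideal with respect to the (degree) reverse lexicographic order on $R$ induced by $$s\prec x_{1,1}\prec\cdots\prec x_{1,n_1}\prec x_{2,1}\prec\cdots\prec x_{2,n_2}\prec\cdots\prec x_{k,1}\prec\cdots\prec x_{k,n_k}\prec t .$$ Then $$\max\{n_1,\dots,n_k\}\le \operatorname{pd}_R\bigl(R/\mathrm{in}_\prec(I_L)\bigr)\le n_1+\cdots+n_k+2 .$$ Moreover, $R/\mathrm{in}_\prec(I_L)$ has a minimal graded free resolution $\cdots\to F_2\to F_1\to F_0\to R/\mathrm{in}_\prec(I_L)\to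 0$ over the standard graded ring $R$, and for every such resolution, with $F_i=\bigoplus_j R(-j)^{B_{i,j}}$, one has $$\binom{n_1}{i}\le\sum_{j=0}^{\infty}B_{i,j}\qquad\text{for } i=1,2,\dots,n_1 .$$ -/

import Mathlib

open CategoryTheory

/-- The underlying set `{s} ∪ {x_{i,j}} ∪ {t}` of the crystal lattice `L_k(n_1, …, n_k)`.
Indices start at `0`: `x i j` is the `(j+1)`-st element of the `(i+1)`-st chain. -/
inductive CrystalLattice {k : ℕ} (n : Fin k → ℕ) : Type
  | s : CrystalLattice n
  | x (i : Fin k) (j : Fin (n i)) : CrystalLattice n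
  | t : CrystalLattice n

namespace CrystalLattice

variable {k : ℕ} {n : Fin k → ℕ}

/-- The order of the crystal lattice: `s < x_{i,1} < ⋯ < x_{i,n_i} < t` for each `i`, and elements
of different chains are incomparable. -/
def le : CrystalLattice n → CrystalLattice n → Prop
  | s, _ => True
  | _, t => True
  | x i a, x j b => i = j ∧ a.val ≤ b.val
  | _, _ => False

/-- The join of two elements. -/
def join : CrystalLattice n → CrystalLattice n → CrystalLattice n
  | s, b => b
  | a, s => a
  | x i a, x j b => if i = j then (if a.val ≤ b.val then x j b else x i a) else t
  | _, _ => t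

/-- The meet of two elements. -/
def meet : CrystalLattice n → CrystalLattice n → CrystalLattice n
  | t, b => b
  | a, t => a
  | x i a, x j b => if i = j then (if a.val ≤ b.val then x i a else x j b) else s
  | _, _ => s

instance : Lattice (CrystalLattice n) where
  le := le
  sup := join
  inf := meet
  le_refl a := by cases a <;> simp [le]
  le_trans a b c := by
    cases a <;> cases b <;> cases c <;> simp [le] <;> grind
  le_antisymm a b := by
    cases a <;> cases b <;> simp [le]
    intro h; subst h; intro h1 _ h2; simp; omega
  le_sup_left a b := by
    cases a <;> cases b <;> simp [le, join]; split_ifs <;> simp_all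
  le_sup_right a b := by
    cases a <;> cases b <;> simp [le, join]; split_ifs <;> simp_all; omega
  sup_le a b c := by
    cases a <;> cases b <;> cases c <;> simp [le, join] <;> (try split_ifs) <;> grind [le]
  inf_le_left a b := by
    cases a <;> cases b <;> simp [le, meet]; split_ifs <;> simp_all; omega
  inf_le_right a b := by
    cases a <;> cases b <;> simp [le, meet]; split_ifs <;> simp_all
  le_inf a b c := by
    cases a <;> cases b <;> cases c <;> simp [le, meet] <;> (try split_ifs) <;> grind [le]

/-- The strict total order on the variables
`s ≺ x_{1,1} ≺ ⋯ ≺ x_{1,n_1} ≺ x_{2,1} ≺ ⋯ ≺ x_{k,n_k} ≺ t`. -/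
def varLT : CrystalLattice n → CrystalLattice n → Prop
  | s, x _ _ => True
  | s, t => True
  | x i a, x j b => i < j ∨ (i = j ∧ a.val < b.val)
  | x _ _, t => True
  | _, _ => False

end CrystalLattice

/-- The join-meet ideal `I_L = (a b - (a ∨ b)(a ∧ b) : a, b ∈ L)` in the polynomial ring `K[L]`. -/
noncomputable def joinMeetIdeal (K : Type*) [CommRing K] (L : Type*) [Lattice L] : Ideal (MvPolynomial L K) :=
  Ideal.span {f | ∃ a b : L, f = MvPolynomial.X a * MvPolynomial.X b -
    MvPolynomial.X (a ⊔ b) * MvPolynomial.X (a ⊓ b)}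

/-- The (degree) reverse lexicographic order on monomials, given by their exponents, that is
induced by the strict total order `r` on the variables: `X^α < X^β` if `deg X^α < deg X^β`, or the
degrees agree and, at the `r`-smallest variable at which `α` and `β` differ, `α` is larger. -/
def RevLexLT {σ : Type*} (r : σ → σ → Prop) (α β : σ →₀ ℕ) : Prop :=
  α.degree < β.degree ∨
    (α.degree = β.degree ∧ ∃ v, β v < α v ∧ ∀ u, r u v → α u = β u)

/-- `α` is the exponent of the initial monomial of `f` in the reverse lexicographic order. -/
def IsInitialExponent {σ K : Type*} [CommSemiring K] (r : σ → σ → Prop) (f : MvPolynomial σ K)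
    (α : σ →₀ ℕ) : Prop :=
  α ∈ f.support ∧ ∀ β ∈ f.support, β ≠ α → RevLexLT r β α

/-- The initial ideal of `I`: the ideal generated by the initial monomials of the non-zero
elements of `I`, in the reverse lexicographic order induced by `r`. -/
noncomputable def initialIdeal {σ K : Type*} [CommSemiring K] (r : σ → σ → Prop)
    (I : Ideal (MvPolynomial σ K)) : Ideal (MvPolynomial σ K) :=
  Ideal.span {m | ∃ f ∈ I, ∃ α, IsInitialExponent r f α ∧ m = MvPolynomial.monomial α 1}

/-- The initial ideal `in_≺(I_{L_k(n_1, …, n_k)})`. -/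
noncomputable def crystalInitialIdeal (K : Type*) [CommRing K] {k : ℕ} (n : Fin k → ℕ) :
    Ideal (MvPolynomial (CrystalLattice n) K) :=
  initialIdeal CrystalLattice.varLT (joinMeetIdeal K (CrystalLattice n))

/-- A minimal graded free resolution
`⋯ → F_2 → F_1 → F_0 → R/J → 0` of `R/J` over the standard graded polynomial ring `R = K[σ]`.
The module `F_i = ⨁_b R(-deg i b)` is free of rank `rank i`, its `b`-th basis vector is
homogeneous of degree `deg i b`, and all the maps preserve degrees. -/
structure MinimalGradedFreeResolution {σ K : Type*} [Field K] (J : Ideal (MvPolynomial σ K)) where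
  /-- the rank of `F_i` -/
  rank : ℕ → ℕ
  /-- the degrees of the basis vectors of `F_i` -/
  deg : ∀ i, Fin (rank i) → ℕ
  /-- the differential `F_{i+1} → F_i` -/
  d : ∀ i, (Fin (rank (i + 1)) → MvPolynomial σ K) →ₗ[MvPolynomial σ K]
    (Fin (rank i) → MvPolynomial σ K)
  /-- the augmentation `F_0 → R/J` -/
  aug : (Fin (rank 0) → MvPolynomial σ K) →ₗ[MvPolynomial σ K] (MvPolynomial σ K ⧸ J)
  aug_surjective : Function.Surjective aug
  exact_aug : Function.Exact (d 0) aug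
  exact_d : ∀ i, Function.Exact (d (i + 1)) (d i)
  /-- the augmentation sends basis vectors to homogeneous elements of the same degree -/
  aug_graded : ∀ b, ∃ p : MvPolynomial σ K, p.IsHomogeneous (deg 0 b) ∧
    aug (Pi.single b 1) = Ideal.Quotient.mk J p
  /-- the differentials preserve degrees: every monomial `X^e` in the entry at `(a, b)` of the
  matrix of `d i` satisfies `deg X^e + deg i a = deg (i + 1) b` -/
  d_graded : ∀ i b a, ∀ e ∈ (d i (Pi.single b 1) a).support, e.degree + deg i a = deg (i + 1) b
  /-- minimality: the entries of the matrices of the differentials lie in the irrelevant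
  maximal ideal -/
  minimal : ∀ i b a, MvPolynomial.constantCoeff (d i (Pi.single b 1) a) = 0

/-- The graded Betti number `B_{i,j}` read off from a minimal graded free resolution: the
multiplicity of the summand `R(-j)` in `F_i`. -/
def MinimalGradedFreeResolution.gradedBetti {σ K : Type*} [Field K]
    {J : Ideal (MvPolynomial σ K)} (F : MinimalGradedFreeResolution J) (i j : ℕ) : ℕ :=
  (Finset.univ.filter fun b => F.deg i b = j).card

/-! Write `J` for the initial ideal, fix a chain `j` other than the first, and let `P` be the prime
generated by all variables except `t` and those on chain `j`. Then `J ⊆ P`, because in a relation `a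
b - t s` both `s` and one of `a`, `b` lie in `P`. Conversely, for `x` on chain `j`, multiplication
by `t x` carries `P` into `J`: the products of `x` with variables of other chains are initial
monomials, and so is `t s x`, by a relation that needs a third chain. So `J` and `P` agree where `t
x` is invertible.

Instead of localizing, the proof takes Ext into the residue field `N` of the point with coordinates
`1` at `t` and on chain `j`, and `0` elsewhere. Since `t x` is `0` on `P/J` and `1` on `N`, all
`Ext(P/J, N)` vanish and `Ext^l(R/P, N)` embeds in `Ext^l(R/J, N)`. A Koszul-type induction bounds
the length of the former below by a binomial coefficient, at least `(n i).choose l` for every `i ≠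
j` (`choose_le_extLength_crystal`). This length bounds ranks in free resolutions
(`extLength_le_rank`), and its non-vanishing at `l = n i` bounds the projective dimension below.

The upper bound is the number of variables, and holds for every monomial ideal, by induction along
`0 → R/(I : y) → R/I → R/(I, y) → 0`. The minimal resolution is built by repeatedly choosing a
smallest homogeneous generating family of the syzygies. -/

/-! ### Lengths of Ext modules -/

section ExtLength

open Abelian

universe u

variable {R : Type u} [CommRing R]

/-- The length of `Ext^i_R(M, N)` as an `R`-module. -/
noncomputable def extLength (R : Type u) [CommRing R] (M N : Type u) [AddCommGroup M] [Module R M]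
    [AddCommGroup N] [Module R N] (i : ℕ) : ℕ∞ :=
  Module.length R (Ext (ModuleCat.of R M) (ModuleCat.of R N) i)

variable {A B C N : Type u} [AddCommGroup A] [Module R A] [AddCommGroup B] [Module R B]
  [AddCommGroup C] [Module R C] [AddCommGroup N] [Module R N]

theorem shortExact_of_linearMap {f : A →ₗ[R] B} {g : B →ₗ[R] C} (hf : Function.Injective f)
    (hg : Function.Surjective g) (h : Function.Exact f g) :
    (ModuleCat.shortComplexOfCompEqZero f g h.linearMap_comp_eq_zero).ShortExact where
  exact := (ShortComplex.ShortExact.moduleCat_exact_iff_function_exact _).mpr h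
  mono_f := (ModuleCat.mono_iff_injective _).mpr hf
  epi_g := (ModuleCat.epi_iff_surjective _).mpr hg

/-- Dimension shifting: `Ext^{i+1}(B, N) = 0`, so the connecting map out of `Ext^i(A, N)` is onto.
-/
theorem extLength_succ_le_of_free [Module.Free R B] {f : A →ₗ[R] B} {g : B →ₗ[R] C}
    (hf : Function.Injective f) (hg : Function.Surjective g) (h : Function.Exact f g) (i : ℕ) :
    extLength R C N (i + 1) ≤ extLength R A N i :=
  Module.length_le_of_surjective
    ((shortExact_of_linearMap hf hg h).extClass.precompOfLinear R (ModuleCat.of R N)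
      (add_comm 1 i)) fun x ↦ Ext.contravariant_sequence_exact₃ (shortExact_of_linearMap hf hg h) _ x
        (Ext.eq_zero_of_projective _) (add_comm 1 i)

theorem extLength_zero_le_of_surjective (g : B →ₗ[R] C) (hg : Function.Surjective g) :
    extLength R C N 0 ≤ extLength R B N 0 :=
  have : Epi (ModuleCat.ofHom g) := (ModuleCat.epi_iff_surjective _).mpr hg
  Module.length_le_of_injective
    ((Ext.mk₀ (ModuleCat.ofHom g)).precompOfLinear R (ModuleCat.of R N) (zero_add 0))
    (Ext.precomp_mk₀_injective_of_epi _ (ModuleCat.ofHom g))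

theorem extLength_le_of_extLength_eq_zero {f : A →ₗ[R] B} {g : B →ₗ[R] C}
    (hf : Function.Injective f) (hg : Function.Surjective g) (h : Function.Exact f g)
    (hA : ∀ i, extLength R A N i = 0) (i : ℕ) :
    extLength R C N i ≤ extLength R B N i := by
  cases i with
  | zero => exact extLength_zero_le_of_surjective g hg
  | succ i =>
    refine Module.length_le_of_injective
      ((Ext.mk₀ (ModuleCat.ofHom g)).precompOfLinear R (ModuleCat.of R N) (zero_add (i + 1))) ?_
    rw [injective_iff_map_eq_zero]
    intro x hx
    obtain ⟨y, rfl⟩ := Ext.contravariant_sequence_exact₃ (shortExact_of_linearMap hf hg h) _ x hx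
      (add_comm 1 i)
    have := Module.length_eq_zero_iff.mp (hA i)
    rw [Subsingleton.elim y 0, Ext.comp_zero]

theorem ext_smul_id_comp {X Y : ModuleCat.{u} R} (r : R) (i : ℕ) (e : Ext X Y i) :
    (Ext.mk₀ (r • 𝟙 X)).comp e (zero_add i) = r • e := by
  simp [Ext.mk₀_smul]

theorem ext_smul_eq_zero {r : R} (hr : ∀ x : N, r • x = 0) (i : ℕ) {X : ModuleCat.{u} R}
    (e : Ext X (ModuleCat.of R N) i) : r • e = 0 := by
  rw [Ext.smul_eq_comp_mk₀]
  have : r • 𝟙 (ModuleCat.of R N) = 0 := by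
    ext x
    exact hr x
  rw [this, Ext.mk₀_zero, Ext.comp_zero]

/-- The action of `r` on Ext can be computed in either argument: through `A` it is `0`, through `N`
it is the identity. -/
theorem extLength_eq_zero {r : R} (hA : ∀ x : A, r • x = 0) (hN : ∀ x : N, r • x = x) (i : ℕ) :
    extLength R A N i = 0 := by
  refine Module.length_eq_zero_iff.mpr (subsingleton_of_forall_eq 0 fun e ↦ ?_)
  have h₁ : r • e = 0 := by
    rw [← ext_smul_id_comp]
    have : r • 𝟙 (ModuleCat.of R A) = 0 := by
      ext x
      exact hA x
    rw [this, Ext.mk₀_zero, Ext.zero_comp]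
  have h₂ : (r - 1) • e = 0 := ext_smul_eq_zero (fun x ↦ by rw [sub_smul, hN, one_smul, sub_self]) i e
  rwa [sub_smul, h₁, one_smul, zero_sub, neg_eq_zero] at h₂

/-- Since `r` kills `N`, it acts as zero on `Ext(A, N)`, and the long exact sequence of `0 → A → A →
C → 0` breaks into short exact sequences `0 → Ext^i(A, N) → Ext^{i+1}(C, N) → Ext^{i+1}(A, N)`, also
exact on the right. -/
theorem add_extLength_le {r : R} {g : A →ₗ[R] C} (hr : IsSMulRegular A r)
    (hg : Function.Surjective g) (h : Function.Exact (LinearMap.lsmul R A r) g)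
    (hN : ∀ x : N, r • x = 0) (i : ℕ) :
    extLength R A N i + extLength R A N (i + 1) ≤ extLength R C N (i + 1) := by
  have hS := shortExact_of_linearMap (f := LinearMap.lsmul R A r) hr hg h
  have hz (j : ℕ) (e : Ext (ModuleCat.of R A) (ModuleCat.of R N) j) :
      (Ext.mk₀ (ModuleCat.ofHom (LinearMap.lsmul R A r))).comp e (zero_add j) = 0 := by
    rw [← ext_smul_eq_zero hN j e, ← ext_smul_id_comp]
    rfl
  refine (Module.length_eq_add_of_exact
    (hS.extClass.precompOfLinear R (ModuleCat.of R N) (add_comm 1 i))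
    ((Ext.mk₀ (ModuleCat.ofHom g)).precompOfLinear R (ModuleCat.of R N) (zero_add (i + 1)))
    ?_ ?_ ?_).ge
  · rw [injective_iff_map_eq_zero]
    intro x hx
    obtain ⟨y, rfl⟩ := Ext.contravariant_sequence_exact₁ hS _ x (add_comm 1 i) hx
    exact hz i y
  · exact fun x ↦ Ext.contravariant_sequence_exact₂ hS _ x (hz (i + 1) x)
  · have := Ext.contravariant_sequence_exact₃' hS (ModuleCat.of R N) i (i + 1) (add_comm 1 i)
    rwa [ShortComplex.ab_exact_iff_function_exact] at this

theorem one_le_extLength_zero {f : A →ₗ[R] N} (hf : f ≠ 0) : 1 ≤ extLength R A N 0 := by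
  rw [Order.one_le_iff_ne_zero]
  intro h
  have := Module.length_eq_zero_iff.mp h
  have h0 : Ext.mk₀ (ModuleCat.ofHom f) = 0 := Subsingleton.elim _ _
  rw [Ext.mk₀_eq_zero_iff] at h0
  exact hf (by simpa using congrArg ModuleCat.Hom.hom h0)

theorem extLength_zero_pi_le (hN : Module.length R N = 1) (r : ℕ) :
    extLength R (Fin r → R) N 0 ≤ r := by
  have e := (Ext.linearEquiv₀ (R := R) (X := ModuleCat.of R (Fin r → R)) (Y := ModuleCat.of R N)).trans
    (ModuleCat.homLinearEquiv (S := R))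
  have e' := e.trans ((Pi.basisFun R (Fin r)).constr R (M' := N)).symm
  rw [extLength, e'.length_eq, Module.length_pi, hN]
  simp

/-- In a free resolution of `M`, the rank of the `i`-th module is at least the length of
`Ext^i(M, N)` for a simple module `N`. -/
theorem extLength_le_rank {M : Type u} [AddCommGroup M] [Module R M]
    (hN : Module.length R N = 1) (rank : ℕ → ℕ)
    (d : ∀ i, (Fin (rank (i + 1)) → R) →ₗ[R] (Fin (rank i) → R))
    (aug : (Fin (rank 0) → R) →ₗ[R] M) (haug : Function.Surjective aug)
    (hexact : Function.Exact (d 0) aug) (hd : ∀ i, Function.Exact (d (i + 1)) (d i)) (i : ℕ) :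
    extLength R M N i ≤ rank i := by
  -- Shift along the images of the differentials: each is the quotient of a free module by the next
  -- image.
  have key (i : ℕ) : ∀ j, extLength R (LinearMap.range (d j)) N i ≤ rank (j + 1 + i) := by
    induction i with
    | zero =>
      exact fun j ↦ (extLength_zero_le_of_surjective _ (d j).surjective_rangeRestrict).trans
        (extLength_zero_pi_le hN _)
    | succ i ih =>
      intro j
      refine (extLength_succ_le_of_free (f := (LinearMap.range (d (j + 1))).subtype)
        (g := (d j).rangeRestrict) (Submodule.subtype_injective _) (d j).surjective_rangeRestrict
        ?_ i).trans ((ih (j + 1)).trans (by rw [show j + 1 + 1 + i = j + 1 + (i + 1) by ring]))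
      rw [LinearMap.exact_iff, LinearMap.ker_rangeRestrict, Submodule.range_subtype]
      exact (LinearMap.exact_iff.mp (hd j))
  cases i with
  | zero => exact (extLength_zero_le_of_surjective _ haug).trans (extLength_zero_pi_le hN _)
  | succ i =>
    refine (extLength_succ_le_of_free (f := (LinearMap.range (d 0)).subtype) (g := aug)
      (Submodule.subtype_injective _) haug ?_ i).trans
        ((key i 0).trans (by rw [show 0 + 1 + i = i + 1 by ring]))
    rw [LinearMap.exact_iff, Submodule.range_subtype]
    exact LinearMap.exact_iff.mp hexact

end ExtLength

/-! ### Monomial ideals: colon sequences and Koszul bounds -/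

section MonomialIdeals

open MvPolynomial

universe u v

variable {K : Type u} [Field K] {σ : Type v}

/-- The hypothesis says that `J` is the colon ideal `I : y`; this is the sequence `0 → R/(I : y) →
R/I → R/(I, y) → 0`. -/
theorem exact_mulLeft_factor {R : Type u} [CommRing R] {I J : Ideal R} (y : R)
    (h : ∀ p, y * p ∈ I ↔ p ∈ J) :
    ∃ (f : (R ⧸ J) →ₗ[R] (R ⧸ I)) (g : (R ⧸ I) →ₗ[R] (R ⧸ (I ⊔ Ideal.span {y}))),
      Function.Injective f ∧ Function.Surjective g ∧ Function.Exact f g ∧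
      (∀ p, f (Ideal.Quotient.mk J p) = Ideal.Quotient.mk I (y * p)) := by
  have hle : J ≤ Submodule.comap (LinearMap.lsmul R R y) I := fun p hp ↦ (h p).mpr hp
  refine ⟨Submodule.mapQ J I (LinearMap.lsmul R R y) hle,
    Submodule.factor le_sup_left, ?_, Submodule.factor_surjective _, ?_, fun p ↦ rfl⟩
  · rw [injective_iff_map_eq_zero]
    intro x hx
    obtain ⟨p, rfl⟩ := Submodule.mkQ_surjective _ x
    rw [Submodule.mkQ_apply, Submodule.mapQ_apply, Submodule.Quotient.mk_eq_zero] at hx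
    rw [Submodule.mkQ_apply, Submodule.Quotient.mk_eq_zero]
    exact (h p).mp hx
  · intro x
    obtain ⟨p, rfl⟩ := Submodule.mkQ_surjective _ x
    rw [Submodule.factor_mk, Submodule.mkQ_apply,
      Submodule.Quotient.mk_eq_zero, Submodule.mem_sup]
    constructor
    · rintro ⟨a, ha, b, hb, rfl⟩
      obtain ⟨c, rfl⟩ := Ideal.mem_span_singleton'.mp hb
      refine ⟨Submodule.Quotient.mk c, ?_⟩
      rw [Submodule.mapQ_apply, Submodule.mkQ_apply, Submodule.Quotient.eq, LinearMap.lsmul_apply,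
        smul_eq_mul,
        mul_comm y c, sub_add_cancel_right]
      exact I.neg_mem ha
    · rintro ⟨q, hq⟩
      obtain ⟨c, rfl⟩ := Submodule.mkQ_surjective _ q
      rw [Submodule.mkQ_apply, Submodule.mapQ_apply, Submodule.mkQ_apply, Submodule.Quotient.eq] at hq
      refine ⟨p - y * c, ?_, y * c, Ideal.mul_mem_right _ _ (Ideal.mem_span_singleton_self y),
        by ring⟩
      rw [← neg_sub]
      exact I.neg_mem hq

/-- The ideal generated by the monomials with exponents in `S`. -/
noncomputable def monomialIdeal (K : Type u) [Field K] (S : Set (σ →₀ ℕ)) :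
    Ideal (MvPolynomial σ K) :=
  Ideal.span ((fun e ↦ monomial e (1 : K)) '' S)

theorem mem_monomialIdeal {S : Set (σ →₀ ℕ)} {p : MvPolynomial σ K} :
    p ∈ monomialIdeal K S ↔ ∀ e ∈ p.support, ∃ s ∈ S, s ≤ e :=
  mem_ideal_span_monomial_image

/-- The ideal generated by the variables in `V`. -/
noncomputable abbrev variableIdeal (K : Type u) [Field K] (V : Set σ) :
    Ideal (MvPolynomial σ K) :=
  Ideal.span (X '' V)

theorem monomialIdeal_single (V : Set σ) :
    monomialIdeal K ((fun v ↦ Finsupp.single v 1) '' V) = variableIdeal K V := by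
  rw [monomialIdeal, Set.image_image]
  rfl

/-- The colon of a monomial ideal by a variable divides each generator by `y` when possible;
truncated subtraction leaves the other generators unchanged. -/
theorem X_mul_mem_monomialIdeal {S : Set (σ →₀ ℕ)} {p : MvPolynomial σ K} (y : σ) :
    X y * p ∈ monomialIdeal K S ↔ p ∈ monomialIdeal K ((· - Finsupp.single y 1) '' S) := by
  simp only [mem_monomialIdeal, support_X_mul, Finset.mem_map, forall_exists_index, and_imp,
    forall_apply_eq_imp_iff₂, Set.exists_mem_image, tsub_le_iff_right, addLeftEmbedding_apply,
    add_comm (Finsupp.single y 1)]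

theorem monomialIdeal_union (S T : Set (σ →₀ ℕ)) :
    monomialIdeal K (S ∪ T) = monomialIdeal K S ⊔ monomialIdeal K T := by
  rw [monomialIdeal, Set.image_union, Ideal.span_union]
  rfl

/-- Once `y` is a generator, those divisible by `y` are redundant, so the remaining ones no longer
involve `y`. -/
theorem monomialIdeal_sup_span_X (S : Set (σ →₀ ℕ)) (y : σ) :
    monomialIdeal K S ⊔ Ideal.span {X y} =
      monomialIdeal K ({e ∈ S | e y = 0} ∪ {Finsupp.single y 1}) := by
  have hy : Ideal.span {X y} = monomialIdeal K ({Finsupp.single y 1} : Set (σ →₀ ℕ)) := by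
    rw [monomialIdeal, Set.image_singleton]
    rfl
  rw [hy, ← monomialIdeal_union]
  ext p
  rw [mem_monomialIdeal, mem_monomialIdeal]
  refine forall₂_congr fun e _ ↦ ⟨?_, ?_⟩
  · rintro ⟨s, hs | hs, hse⟩
    · by_cases h : s y = 0
      · exact ⟨s, .inl ⟨hs, h⟩, hse⟩
      · refine ⟨_, .inr rfl, le_trans ?_ hse⟩
        rw [Finsupp.single_le_iff]
        omega
    · exact ⟨s, .inr hs, hse⟩
  · rintro ⟨s, hs | hs, hse⟩
    · exact ⟨s, .inl hs.1, hse⟩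
    · exact ⟨s, .inr hs, hse⟩

theorem span_X_insert (V : Finset σ) (y : σ) [DecidableEq σ] :
    variableIdeal K (↑(insert y V) : Set σ) = variableIdeal K (V : Set σ) ⊔ Ideal.span {X y} := by
  rw [variableIdeal, Finset.coe_insert, Set.image_insert_eq, Set.insert_eq, Ideal.span_union, sup_comm]

theorem X_mul_mem_span_X {V : Set σ} {y : σ} (hy : y ∉ V) (p : MvPolynomial σ K) :
    X y * p ∈ variableIdeal K V ↔ p ∈ variableIdeal K V := by
  rw [← monomialIdeal_single, X_mul_mem_monomialIdeal, Set.image_image]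
  refine iff_of_eq (congrArg (p ∈ monomialIdeal K ·) (Set.image_congr fun v hv ↦ ?_))
  classical
  ext w
  have : y ≠ v := fun h ↦ hy (h ▸ hv)
  simp only [Finsupp.tsub_apply, Finsupp.single_apply]
  grind

theorem one_le_extLength_variableIdeal (V : Set σ) {N : Type (max u v)} [AddCommGroup N]
    [Module (MvPolynomial σ K) N] [Nontrivial N]
    (hN : ∀ v ∈ V, ∀ x : N, (X v : MvPolynomial σ K) • x = 0) :
    1 ≤ extLength (MvPolynomial σ K) (MvPolynomial σ K ⧸ variableIdeal K V) N 0 := by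
  obtain ⟨x, hx⟩ := exists_ne (0 : N)
  have hle : variableIdeal K V ≤
      LinearMap.ker (LinearMap.toSpanSingleton (MvPolynomial σ K) N x) := by
    refine Submodule.span_le.mpr ?_
    rintro _ ⟨v, hv, rfl⟩
    exact hN v hv x
  refine one_le_extLength_zero (f := Submodule.liftQ _ _ hle) fun h ↦ hx ?_
  have := LinearMap.congr_fun h (Submodule.mkQ _ 1)
  rwa [Submodule.mkQ_apply, Submodule.liftQ_apply, LinearMap.toSpanSingleton_apply, one_smul]
    at this

/-- The variables form a regular sequence acting as zero on `N`, so adding one contributes two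
consecutive Ext lengths, matching Pascal's rule. -/
theorem choose_le_extLength (V : Finset σ) {N : Type (max u v)} [AddCommGroup N]
    [Module (MvPolynomial σ K) N] [Nontrivial N]
    (hN : ∀ v ∈ V, ∀ x : N, (X v : MvPolynomial σ K) • x = 0) (i : ℕ) :
    (V.card.choose i : ℕ∞) ≤
      extLength (MvPolynomial σ K) (MvPolynomial σ K ⧸ variableIdeal K (V : Set σ)) N i := by
  classical
  induction V using Finset.induction_on generalizing i with
  | empty =>
    cases i with
    | succ i => simp
    | zero =>
      simpa using one_le_extLength_variableIdeal (K := K) _ hN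
  | insert y V hy ih =>
    cases i with
    | zero =>
      simpa using one_le_extLength_variableIdeal (K := K) _ hN
    | succ i =>
      have ih' := ih fun v hv ↦ hN v (Finset.mem_insert_of_mem hv)
      rw [Finset.card_insert_of_notMem hy, Nat.choose_succ_succ, Nat.cast_add, span_X_insert]
      obtain ⟨f, g, hf, hg, hfg, hfm⟩ := exact_mulLeft_factor (X y : MvPolynomial σ K)
        (X_mul_mem_span_X (K := K) (V := V) (by simpa using hy))
      -- As `y` is regular modulo the other variables, the colon ideal is the ideal itself and `f`
      -- is multiplication by `y` on a single module.
      obtain rfl : f = LinearMap.lsmul _ _ (X y : MvPolynomial σ K) := by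
        ext
        exact (hfm 1).trans rfl
      exact (add_le_add (ih' i) (ih' (i + 1))).trans
        (add_extLength_le hf hg hfg (hN y (Finset.mem_insert_self y V)) i)

/-! ### Projective dimension of quotients by monomial ideals -/

theorem hasProjectiveDimensionLE_mono {C : Type*} [Category* C] [Abelian C] {M : C} {m n : ℕ}
    (h : HasProjectiveDimensionLE M m) (hmn : m ≤ n) : HasProjectiveDimensionLE M n :=
  hasProjectiveDimensionLT_of_ge M (m + 1) (n + 1) (Nat.succ_le_succ hmn)

theorem hasProjectiveDimensionLE_sup {R : Type u} [CommRing R] {I J : Ideal R} (y : R)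
    (h : ∀ p, y * p ∈ I ↔ p ∈ J) (n : ℕ)
    (hJ : HasProjectiveDimensionLE (ModuleCat.of R (R ⧸ J)) n)
    (hI : HasProjectiveDimensionLE (ModuleCat.of R (R ⧸ I)) n) :
    HasProjectiveDimensionLE (ModuleCat.of R (R ⧸ (I ⊔ Ideal.span {y}))) (n + 1) := by
  obtain ⟨f, g, hf, hg, hfg, -⟩ := exact_mulLeft_factor y h
  exact (shortExact_of_linearMap hf hg hfg).hasProjectiveDimensionLT_X₃ (n + 1) hJ
    (hasProjectiveDimensionLE_mono hI n.le_succ)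

theorem hasProjectiveDimensionLE_of_colon {R : Type u} [CommRing R] {I J : Ideal R} (y : R)
    (h : ∀ p, y * p ∈ I ↔ p ∈ J) (n : ℕ)
    (hJ : HasProjectiveDimensionLE (ModuleCat.of R (R ⧸ J)) n)
    (hI : HasProjectiveDimensionLE (ModuleCat.of R (R ⧸ (I ⊔ Ideal.span {y}))) n) :
    HasProjectiveDimensionLE (ModuleCat.of R (R ⧸ I)) n := by
  obtain ⟨f, g, hf, hg, hfg, -⟩ := exact_mulLeft_factor y h
  exact (shortExact_of_linearMap hf hg hfg).hasProjectiveDimensionLT_X₂ (n + 1) hJ hI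

theorem hasProjectiveDimensionLE_span_X (V : Finset σ) :
    HasProjectiveDimensionLE (ModuleCat.of (MvPolynomial σ K)
      (MvPolynomial σ K ⧸ variableIdeal K (V : Set σ))) V.card := by
  classical
  induction V using Finset.induction_on with
  | empty =>
    have : Module.Free (MvPolynomial σ K)
        (MvPolynomial σ K ⧸ variableIdeal K ((∅ : Finset σ) : Set σ)) :=
      Module.Free.of_equiv (Submodule.quotEquivOfEqBot _ (by simp)).symm
    exact (projective_iff_hasProjectiveDimensionLE_zero _).mp inferInstance
  | insert y V hy ih =>
    rw [Finset.card_insert_of_notMem hy, span_X_insert]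
    exact hasProjectiveDimensionLE_sup _ (X_mul_mem_span_X (by simpa using hy)) _ ih ih

/-- `V` holds the variables still to be treated, `W` those allowed as bare generators. For `y` in
`V`, passing to the colon by `y` lowers the exponents of `y`, while adding `y` as a generator moves
it from `V` to `W` and does not increase the bound. With `V` empty, the ideal is the unit ideal or
is generated by variables. -/
theorem hasProjectiveDimensionLE_monomialIdeal (V W : Finset σ) (S : Set (σ →₀ ℕ))
    (hfin : S.Finite) (hS : ∀ e ∈ S, e.support ⊆ V ∨ ∃ w ∈ W, e = Finsupp.single w 1) :
    HasProjectiveDimensionLE (ModuleCat.of (MvPolynomial σ K)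
      (MvPolynomial σ K ⧸ monomialIdeal K S)) (V.card + W.card) := by
  classical
  induction V using Finset.induction_on generalizing S W with
  | empty =>
    by_cases h0 : (0 : σ →₀ ℕ) ∈ S
    · have htop : monomialIdeal K S = ⊤ :=
        (Ideal.eq_top_iff_one _).mpr (Ideal.subset_span ⟨0, h0, rfl⟩)
      have : Subsingleton (MvPolynomial σ K ⧸ monomialIdeal K S) :=
        Ideal.Quotient.subsingleton_iff.mpr htop
      have := (ModuleCat.isZero_of_subsingleton (ModuleCat.of (MvPolynomial σ K)
        (MvPolynomial σ K ⧸ monomialIdeal K S))).hasProjectiveDimensionLT_zero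
      exact hasProjectiveDimensionLT_of_ge _ 0 _ (Nat.zero_le _)
    · let W' := W.filter fun w ↦ Finsupp.single w 1 ∈ S
      have hSW : S = (fun v ↦ Finsupp.single v 1) '' (W' : Set σ) := by
        ext e
        constructor
        · intro he
          rcases hS e he with h | ⟨w, hw, rfl⟩
          · rw [Finset.subset_empty, Finsupp.support_eq_empty] at h
            exact absurd (h ▸ he) h0
          · exact ⟨w, by simp [W', hw, he], rfl⟩
        · rintro ⟨w, hw, rfl⟩
          exact (Finset.mem_filter.mp hw).2
      rw [hSW, monomialIdeal_single]
      have := hasProjectiveDimensionLE_span_X (K := K) W'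
      have hle : W'.card ≤ W.card := Finset.card_filter_le _ _
      exact hasProjectiveDimensionLE_mono this (hle.trans (Nat.le_add_left _ _))
  | insert y V hy ih =>
    -- An inner induction on a bound for the `y`-exponents of the generators makes repeated colons
    -- by `y` terminate.
    obtain ⟨b, hb⟩ : ∃ b, ∀ e ∈ S, e y ≤ b :=
      (hfin.image fun e ↦ e y).bddAbove.imp fun b hb e he ↦ hb ⟨e, he, rfl⟩
    rw [Finset.card_insert_of_notMem hy]
    induction b generalizing S with
    | zero =>
      have := ih W S hfin fun e he ↦ (hS e he).imp_left fun h v hv ↦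
        (Finset.mem_insert.mp (h hv)).resolve_left fun hvy ↦
          Finsupp.mem_support_iff.mp hv (hvy ▸ Nat.le_zero.mp (hb e he))
      exact hasProjectiveDimensionLE_mono this (by omega)
    | succ b ihb =>
      refine hasProjectiveDimensionLE_of_colon _ (fun p ↦ X_mul_mem_monomialIdeal y) _
        (ihb _ (hfin.image _) ?_ ?_) ?_
      · rintro _ ⟨e, he, rfl⟩
        rcases hS e he with h | ⟨w, hw, rfl⟩
        · exact .inl (Finsupp.support_tsub.trans h)
        · by_cases hwy : w = y
          · left
            simp [hwy]
          · refine .inr ⟨w, hw, ?_⟩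
            ext v
            simp only [Finsupp.tsub_apply, Finsupp.single_apply]
            grind
      · rintro _ ⟨e, he, rfl⟩
        have := hb e he
        simp only [Finsupp.tsub_apply, Finsupp.single_eq_same]
        omega
      · rw [monomialIdeal_sup_span_X]
        have := ih (insert y W) ({e ∈ S | e y = 0} ∪ {Finsupp.single y 1})
          ((hfin.subset (Set.sep_subset _ _)).union (Set.finite_singleton _)) ?_
        · have hle := Finset.card_insert_le y W
          exact hasProjectiveDimensionLE_mono this (by omega)
        · rintro e (⟨he, hey⟩ | rfl)
          · rcases hS e he with h | ⟨w, hw, rfl⟩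
            · exact .inl fun v hv ↦ (Finset.mem_insert.mp (h hv)).resolve_left fun hvy ↦
                Finsupp.mem_support_iff.mp hv (hvy ▸ hey)
            · exact .inr ⟨w, Finset.mem_insert_of_mem hw, rfl⟩
          · exact .inr ⟨y, Finset.mem_insert_self y W, rfl⟩

/-- The quotient by a monomial ideal has projective dimension at most the number of variables. -/
theorem hasProjectiveDimensionLE_quotient_monomialIdeal [Fintype σ]
    (S : Set (σ →₀ ℕ)) :
    HasProjectiveDimensionLE (ModuleCat.of (MvPolynomial σ K)
      (MvPolynomial σ K ⧸ monomialIdeal K S)) (Fintype.card σ) := by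
  obtain ⟨T, hTS, hT⟩ := Submodule.fg_span_iff_fg_span_finset_subset _ |>.mp
    (IsNoetherian.noetherian (monomialIdeal K S))
  classical
  obtain ⟨S', hS', rfl⟩ := Finset.subset_set_image_iff.mp hTS
  have hS : monomialIdeal K S = monomialIdeal K (S' : Set (σ →₀ ℕ)) := by
    rw [monomialIdeal, monomialIdeal, ← Finset.coe_image]
    exact hT
  have := hasProjectiveDimensionLE_monomialIdeal (K := K) Finset.univ ∅ (S' : Set (σ →₀ ℕ))
    S'.finite_toSet fun e _ ↦ .inl (Finset.subset_univ _)
  rwa [hS]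

end MonomialIdeals

/-! ### Existence of minimal graded free resolutions -/

section GradedResolution

open MvPolynomial

variable {K : Type*} [Field K] {σ : Type*} {r : ℕ}

/-- The degree `e` part of a vector, where the `a`-th basis vector has degree `deg a`. -/
noncomputable def gradedPart (deg : Fin r → ℕ) (e : ℕ) :
    (Fin r → MvPolynomial σ K) →ₗ[K] (Fin r → MvPolynomial σ K) :=
  LinearMap.pi fun a ↦
    -- The guard is needed because `e - deg a` truncates to `0`, which would select constants in the
    -- wrong degree.
    if deg a ≤ e then homogeneousComponent (e - deg a) ∘ₗ LinearMap.proj a else 0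

theorem coeff_gradedPart (deg : Fin r → ℕ) (e : ℕ) (v : Fin r → MvPolynomial σ K) (a : Fin r)
    (m : σ →₀ ℕ) :
    coeff m (gradedPart deg e v a) = if m.degree + deg a = e then coeff m (v a) else 0 := by
  rw [gradedPart, LinearMap.pi_apply]
  split_ifs with h₁ h₂ h₂
  · rw [LinearMap.comp_apply, coeff_homogeneousComponent, if_pos (by omega), LinearMap.proj_apply]
  · rw [LinearMap.comp_apply, coeff_homogeneousComponent, if_neg (by omega)]
  · omega
  · simp

/-- A vector is homogeneous of degree `e` if it equals its degree `e` part. -/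
def IsGradedHomogeneous (deg : Fin r → ℕ) (e : ℕ) (v : Fin r → MvPolynomial σ K) : Prop :=
  ∀ a, ∀ m ∈ (v a).support, m.degree + deg a = e

theorem isGradedHomogeneous_gradedPart (deg : Fin r → ℕ) (e : ℕ) (v : Fin r → MvPolynomial σ K) :
    IsGradedHomogeneous deg e (gradedPart deg e v) := by
  intro a m hm
  by_contra h
  rw [mem_support_iff, coeff_gradedPart, if_neg h] at hm
  exact hm rfl

theorem IsGradedHomogeneous.gradedPart_eq {deg : Fin r → ℕ} {e : ℕ}
    {v : Fin r → MvPolynomial σ K} (hv : IsGradedHomogeneous deg e v) (e' : ℕ) :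
    gradedPart deg e' v = if e = e' then v else 0 := by
  ext a m
  rw [coeff_gradedPart]
  by_cases hm : m ∈ (v a).support
  · rw [hv a m hm]
    split_ifs <;> simp
  · rw [notMem_support_iff] at hm
    split_ifs <;> simp [hm]

theorem isGradedHomogeneous_single (deg : Fin r → ℕ) (b : Fin r) (m : σ →₀ ℕ) (c : K) :
    IsGradedHomogeneous deg (m.degree + deg b) (Pi.single b (monomial m c)) := by
  intro a m' hm'
  by_cases hab : a = b
  · subst hab
    rw [Pi.single_eq_same] at hm'
    rw [Finset.mem_singleton.mp (support_monomial_subset hm')]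
  · simp [Pi.single_eq_of_ne hab] at hm'

theorem IsGradedHomogeneous.monomial_smul {deg : Fin r → ℕ} {e : ℕ}
    {v : Fin r → MvPolynomial σ K} (hv : IsGradedHomogeneous deg e v) (m : σ →₀ ℕ) (c : K) :
    IsGradedHomogeneous deg (m.degree + e) (monomial m c • v) := by
  classical
  intro a m' hm'
  obtain ⟨x, hx, y, hy, rfl⟩ := Finset.mem_add.mp (support_mul _ _ hm')
  rw [Finset.mem_singleton.mp (support_monomial_subset hx), map_add, ← hv a y hy, add_assoc]

theorem eq_sum_gradedPart (deg : Fin r → ℕ) (v : Fin r → MvPolynomial σ K) :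
    ∃ n, v = ∑ e ∈ Finset.range n, gradedPart deg e v := by
  refine ⟨Finset.univ.sup (fun a ↦ (v a).totalDegree + deg a) + 1, ?_⟩
  ext a m
  rw [Finset.sum_apply, coeff_sum]
  simp only [coeff_gradedPart, Finset.sum_ite_eq, Finset.mem_range]
  split_ifs with h
  · rfl
  · rw [← notMem_support_iff]
    intro hm
    have h₁ := le_totalDegree hm
    have h₂ := Finset.le_sup (f := fun a ↦ (v a).totalDegree + deg a) (Finset.mem_univ a)
    rw [Finsupp.degree_apply] at h
    change m.sum (fun _ e ↦ e) ≤ _ at h₁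
    rw [Finsupp.sum] at h₁
    omega

/-- A submodule is graded if it contains the homogeneous parts of its elements. -/
def IsGradedSubmodule (deg : Fin r → ℕ)
    (Z : Submodule (MvPolynomial σ K) (Fin r → MvPolynomial σ K)) : Prop :=
  ∀ v ∈ Z, ∀ e, gradedPart deg e v ∈ Z

theorem gradedPart_linearCombination {r' : ℕ} {deg : Fin r → ℕ} {deg' : Fin r' → ℕ}
    {g : Fin r' → Fin r → MvPolynomial σ K} (hg : ∀ b, IsGradedHomogeneous deg (deg' b) (g b))
    (e : ℕ) (v : Fin r' → MvPolynomial σ K) :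
    gradedPart deg e (Fintype.linearCombination (MvPolynomial σ K) g v) =
      Fintype.linearCombination (MvPolynomial σ K) g (gradedPart deg' e v) := by
  have : gradedPart deg e ∘ₗ (Fintype.linearCombination (MvPolynomial σ K) g).restrictScalars K =
      (Fintype.linearCombination (MvPolynomial σ K) g).restrictScalars K ∘ₗ gradedPart deg' e := by
    refine LinearMap.pi_ext' fun b ↦ linearMap_ext fun m ↦ LinearMap.ext_ring ?_
    simp only [LinearMap.comp_apply, LinearMap.single_apply, LinearMap.restrictScalars_apply]
    rw [(isGradedHomogeneous_single deg' b m 1).gradedPart_eq,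
      Fintype.linearCombination_apply_single, ((hg b).monomial_smul m 1).gradedPart_eq]
    split_ifs
    · rw [Fintype.linearCombination_apply_single]
    · rw [map_zero]
  exact LinearMap.congr_fun this v

theorem IsGradedSubmodule.exists_homogeneous_generators [Finite σ] {deg : Fin r → ℕ}
    {Z : Submodule (MvPolynomial σ K) (Fin r → MvPolynomial σ K)} (hZ : IsGradedSubmodule deg Z) :
    ∃ (s : ℕ) (g : Fin s → Fin r → MvPolynomial σ K),
      (∀ b, ∃ e, IsGradedHomogeneous deg e (g b)) ∧
      Submodule.span (MvPolynomial σ K) (Set.range g) = Z := by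
  have hspan : Submodule.span (MvPolynomial σ K) {v ∈ Z | ∃ e, IsGradedHomogeneous deg e v} = Z := by
    refine le_antisymm (Submodule.span_le.mpr fun v hv ↦ hv.1) fun v hv ↦ ?_
    obtain ⟨n, hn⟩ := eq_sum_gradedPart deg v
    rw [hn]
    exact Submodule.sum_mem _ fun e _ ↦
      Submodule.subset_span ⟨hZ v hv e, e, isGradedHomogeneous_gradedPart deg e v⟩
  obtain ⟨T, hT, hTZ⟩ := (Submodule.fg_span_iff_fg_span_finset_subset _).mp
    (hspan ▸ IsNoetherian.noetherian Z)
  refine ⟨T.card, fun b ↦ (T.equivFin.symm b : Fin r → MvPolynomial σ K),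
    fun b ↦ (hT (T.equivFin.symm b).2).2, ?_⟩
  rw [← hspan, hTZ]
  congr 1
  ext v
  constructor
  · rintro ⟨b, rfl⟩
    exact (T.equivFin.symm b).2
  · exact fun hv ↦ ⟨T.equivFin ⟨v, hv⟩, by simp⟩

/-- A graded submodule of a graded free module of finite rank has a minimal graded free cover. -/
theorem IsGradedSubmodule.exists_minimal_cover [Finite σ] {deg : Fin r → ℕ}
    {Z : Submodule (MvPolynomial σ K) (Fin r → MvPolynomial σ K)} (hZ : IsGradedSubmodule deg Z) :
    ∃ (r' : ℕ) (deg' : Fin r' → ℕ)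
      (d : (Fin r' → MvPolynomial σ K) →ₗ[MvPolynomial σ K] (Fin r → MvPolynomial σ K)),
      LinearMap.range d = Z ∧ (∀ b, IsGradedHomogeneous deg (deg' b) (d (Pi.single b 1))) ∧
      (∀ v ∈ LinearMap.ker d, ∀ b, constantCoeff (v b) = 0) ∧
      IsGradedSubmodule deg' (LinearMap.ker d) := by
  classical
  -- A homogeneous generating family of least cardinality; a relation with a nonzero constant
  -- coefficient would make one generator superfluous.
  obtain ⟨r', ⟨g, hg, hgZ⟩, hmin⟩ : ∃ s : ℕ, (∃ g : Fin s → Fin r → MvPolynomial σ K,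
      (∀ b, ∃ e, IsGradedHomogeneous deg e (g b)) ∧
      Submodule.span (MvPolynomial σ K) (Set.range g) = Z) ∧ ∀ s' < s,
      ¬ ∃ g : Fin s' → Fin r → MvPolynomial σ K,
      (∀ b, ∃ e, IsGradedHomogeneous deg e (g b)) ∧
      Submodule.span (MvPolynomial σ K) (Set.range g) = Z :=
    ⟨_, Nat.find_spec hZ.exists_homogeneous_generators,
      fun _ ↦ Nat.find_min hZ.exists_homogeneous_generators⟩
  choose deg' hdeg' using hg
  have hker : IsGradedSubmodule deg'
      (LinearMap.ker (Fintype.linearCombination (MvPolynomial σ K) g)) := fun v hv e ↦ by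
    rw [LinearMap.mem_ker, ← gradedPart_linearCombination hdeg', LinearMap.mem_ker.mp hv, map_zero]
  refine ⟨r', deg', Fintype.linearCombination (MvPolynomial σ K) g, ?_, fun b ↦ ?_,
    fun v hv b ↦ ?_, hker⟩
  · rw [Fintype.range_linearCombination, hgZ]
  · rw [Fintype.linearCombination_apply_single, one_smul]
    exact hdeg' b
  · by_contra hc
    cases r' with
    | zero => exact b.elim0
    | succ s =>
      refine hmin s s.lt_succ_self ⟨fun i ↦ g (b.succAbove i), fun i ↦ ⟨_, hdeg' _⟩, ?_⟩
      rw [← hgZ]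
      refine le_antisymm (Submodule.span_mono (by rintro _ ⟨i, rfl⟩; exact ⟨_, rfl⟩))
        (Submodule.span_le.mpr ?_)
      have hmem (i : Fin s) : g (b.succAbove i) ∈ Submodule.span (MvPolynomial σ K)
          (Set.range fun i ↦ g (b.succAbove i)) := Submodule.subset_span ⟨i, rfl⟩
      rintro _ ⟨i, rfl⟩
      rcases Fin.eq_self_or_eq_succAbove b i with rfl | ⟨i, rfl⟩
      -- In the part of the relation of degree `deg' i`, the coefficient of `g i` is exactly its
      -- constant term, a unit, so `g i` is a combination of the other generators.
      · have h0 := LinearMap.mem_ker.mp (hker v hv (deg' i))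
        rw [Fintype.linearCombination_apply, Fin.sum_univ_succAbove _ i] at h0
        have hC : gradedPart deg' (deg' i) v i = C (constantCoeff (v i)) := by
          ext m
          rw [coeff_gradedPart, coeff_C, constantCoeff_eq]
          by_cases hm : m = 0
          · simp [hm]
          · rw [if_neg (Ne.symm hm), if_neg]
            rw [Nat.add_eq_right, Finsupp.degree_eq_zero_iff]
            exact hm
        have h1 : g i = (C (constantCoeff (v i))⁻¹ : MvPolynomial σ K) •
            ((C (constantCoeff (v i)) : MvPolynomial σ K) • g i) := by
          rw [smul_smul, ← C_mul, inv_mul_cancel₀ hc, C_1, one_smul]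
        rw [h1, ← hC, eq_neg_of_add_eq_zero_left h0]
        exact Submodule.smul_mem _ _ (Submodule.neg_mem _
          (Submodule.sum_mem _ fun j _ ↦ Submodule.smul_mem _ _ (hmem j)))
      · exact hmem i

/-- A graded free module of finite rank with a graded submodule contained in the product of the
module with the irrelevant ideal. -/
structure GradedSyzygy (σ K : Type*) [Field K] where
  /-- the rank of the free module -/
  rank : ℕ
  /-- the degrees of the basis vectors -/
  deg : Fin rank → ℕ
  /-- the submodule -/
  carrier : Submodule (MvPolynomial σ K) (Fin rank → MvPolynomial σ K)
  graded : IsGradedSubmodule deg carrier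
  minimal : ∀ v ∈ carrier, ∀ b, constantCoeff (v b) = 0

theorem GradedSyzygy.exists_next [Finite σ] (Z : GradedSyzygy σ K) :
    ∃ (Z' : GradedSyzygy σ K)
      (d : (Fin Z'.rank → MvPolynomial σ K) →ₗ[MvPolynomial σ K] (Fin Z.rank → MvPolynomial σ K)),
      LinearMap.range d = Z.carrier ∧ LinearMap.ker d = Z'.carrier ∧
      ∀ b, IsGradedHomogeneous Z.deg (Z'.deg b) (d (Pi.single b 1)) := by
  obtain ⟨r', deg', d, hr, hd, hm, hk⟩ := Z.graded.exists_minimal_cover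
  exact ⟨⟨r', deg', LinearMap.ker d, hk, hm⟩, d, hr, rfl, hd⟩

/-- The quotient by a proper ideal that is closed under taking homogeneous components has a minimal
graded free resolution. -/
theorem nonempty_minimalGradedFreeResolution [Finite σ] (J : Ideal (MvPolynomial σ K))
    (hJ : ∀ p ∈ J, ∀ e, homogeneousComponent e p ∈ J) (hJ0 : ∀ p ∈ J, constantCoeff p = 0) :
    Nonempty (MinimalGradedFreeResolution J) := by
  let aug : (Fin 1 → MvPolynomial σ K) →ₗ[MvPolynomial σ K] (MvPolynomial σ K ⧸ J) :=
    J.mkQ ∘ₗ LinearMap.proj 0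
  have haug (v) : v ∈ LinearMap.ker aug ↔ v 0 ∈ J := by
    rw [LinearMap.mem_ker]
    exact Submodule.Quotient.mk_eq_zero J
  let Z₀ : GradedSyzygy σ K :=
    { rank := 1
      deg := 0
      carrier := LinearMap.ker aug
      graded := fun v hv e ↦ by
        rw [haug] at hv ⊢
        simpa [gradedPart] using hJ _ hv e
      minimal := fun v hv b ↦ by
        rw [Subsingleton.elim b 0]
        exact hJ0 _ ((haug v).mp hv) }
  choose next d hrange hker hhom using GradedSyzygy.exists_next (σ := σ) (K := K)
  let Z (i : ℕ) : GradedSyzygy σ K := Nat.rec Z₀ (fun _ ↦ next) i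
  refine ⟨{
    rank := fun i ↦ (Z i).rank
    deg := fun i ↦ (Z i).deg
    d := fun i ↦ d (Z i)
    aug := aug
    aug_surjective := fun x ↦ ?_
    exact_aug := LinearMap.exact_iff.mpr (hrange Z₀).symm
    exact_d := fun i ↦ LinearMap.exact_iff.mpr ((hker (Z i)).trans (hrange (Z (i + 1))).symm)
    aug_graded := fun b ↦ ⟨1, isHomogeneous_one σ K, ?_⟩
    d_graded := fun i b a m hm ↦ hhom (Z i) b a m hm
    minimal := fun i b a ↦ (Z i).minimal _ (hrange (Z i) ▸ LinearMap.mem_range_self _ _) a }⟩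
  · obtain ⟨p, rfl⟩ := J.mkQ_surjective x
    exact ⟨fun _ ↦ p, rfl⟩
  · obtain rfl : b = (0 : Fin 1) := Subsingleton.elim (α := Fin 1) b 0
    rfl

theorem MinimalGradedFreeResolution.finsum_gradedBetti {J : Ideal (MvPolynomial σ K)}
    (F : MinimalGradedFreeResolution J) (i : ℕ) : ∑ᶠ j : ℕ, F.gradedBetti i j = F.rank i := by
  classical
  rw [finsum_eq_sum_of_support_subset (s := Finset.univ.image (F.deg i))]
  · exact (Finset.card_eq_sum_card_fiberwise fun b _ ↦
      Finset.mem_image_of_mem _ (Finset.mem_univ b)).symm.trans (Finset.card_fin _)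
  · intro j hj
    obtain ⟨b, hb⟩ := Finset.card_ne_zero.mp hj
    exact Finset.mem_coe.mpr
      (Finset.mem_image.mpr ⟨b, Finset.mem_univ b, (Finset.mem_filter.mp hb).2⟩)

end GradedResolution

/-! ### Initial ideals -/

section InitialIdeals

open MvPolynomial

theorem initialIdeal_eq_monomialIdeal {σ K : Type*} [Field K] (r : σ → σ → Prop)
    (I : Ideal (MvPolynomial σ K)) :
    initialIdeal r I = monomialIdeal K {α | ∃ f ∈ I, IsInitialExponent r f α} := by
  rw [initialIdeal, monomialIdeal]
  congr 1
  ext m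
  constructor
  · rintro ⟨f, hf, α, hα, rfl⟩
    exact ⟨α, ⟨f, hf, hα⟩, rfl⟩
  · rintro ⟨α, ⟨f, hf, hα⟩, rfl⟩
    exact ⟨f, hf, α, hα, rfl⟩

theorem homogeneousComponent_mem_monomialIdeal {σ K : Type*} [Field K] {S : Set (σ →₀ ℕ)}
    {p : MvPolynomial σ K} (hp : p ∈ monomialIdeal K S) (e : ℕ) :
    homogeneousComponent e p ∈ monomialIdeal K S := by
  rw [mem_monomialIdeal] at hp ⊢
  intro m hm
  refine hp m ?_
  rw [mem_support_iff, coeff_homogeneousComponent] at hm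
  exact mem_support_iff.mpr fun h ↦ hm (by rw [h, ite_self])

/-- Every monomial of a polynomial in `variableIdeal K V`, in particular its initial one, is
divisible by a variable in `V`. -/
theorem initialIdeal_le_variableIdeal {σ K : Type*} [Field K] (r : σ → σ → Prop)
    {I : Ideal (MvPolynomial σ K)} {V : Set σ} (h : I ≤ variableIdeal K V) :
    initialIdeal r I ≤ variableIdeal K V := by
  refine Ideal.span_le.mpr ?_
  rintro _ ⟨f, hf, α, hα, rfl⟩
  refine mem_ideal_span_X_image.mpr fun m hm ↦ ?_
  rw [Finset.mem_singleton.mp (support_monomial_subset hm)]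
  exact mem_ideal_span_X_image.mp (h hf) α hα.1

theorem monomial_mem_initialIdeal {σ K : Type*} [Field K] {r : σ → σ → Prop}
    {I : Ideal (MvPolynomial σ K)} {α β : σ →₀ ℕ} (hI : monomial α 1 - monomial β 1 ∈ I)
    (hne : β ≠ α) (hlt : RevLexLT r β α) : monomial α 1 ∈ initialIdeal r I := by
  classical
  refine Ideal.subset_span ⟨_, hI, α, ⟨?_, fun γ hγ hγα ↦ ?_⟩, rfl⟩
  · simp [mem_support_iff, coeff_monomial, hne]
  · have : γ = β := by
      by_contra hγβ
      simp [mem_support_iff, coeff_monomial, Ne.symm hγα, Ne.symm hγβ] at hγ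
    rwa [this]

end InitialIdeals

/-! ### Initial monomials of the crystal lattice ideal -/

section Crystal

open MvPolynomial CrystalLattice

universe u

variable {K : Type u} [Field K] {k : ℕ} {n : Fin k → ℕ}

/-- The elements of the crystal lattice as a sum type. -/
def CrystalLattice.equivOption : CrystalLattice n ≃ Option (Option (Σ i, Fin (n i))) where
  toFun
    | s => none
    | t => some none
    | x i a => some (some ⟨i, a⟩)
  invFun
    | none => s
    | some none => t
    | some (some p) => x p.1 p.2
  left_inv v := by cases v <;> rfl
  right_inv v := by rcases v with _ | _ | _ <;> rfl

noncomputable instance : Fintype (CrystalLattice n) := Fintype.ofEquiv _ equivOption.symm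

noncomputable instance : DecidableEq (CrystalLattice n) := Classical.decEq _

theorem card_crystalLattice : Fintype.card (CrystalLattice n) = ∑ i, n i + 2 := by
  rw [Fintype.card_congr equivOption]
  simp

theorem CrystalLattice.s_le (v : CrystalLattice n) : s ≤ v := by
  cases v <;> trivial

theorem CrystalLattice.le_t (v : CrystalLattice n) : v ≤ t := by
  cases v <;> trivial

theorem X_mul_X_sub_mem_joinMeetIdeal {i j : Fin k} (h : i ≠ j) (a : Fin (n i)) (b : Fin (n j)) :
    X (x i a) * X (x j b) - X t * X s ∈ joinMeetIdeal K (CrystalLattice n) := by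
  refine Ideal.subset_span ⟨x i a, x j b, ?_⟩
  have h₁ : x i a ⊔ x j b = t := if_neg h
  have h₂ : x i a ⊓ x j b = s := if_neg h
  rw [h₁, h₂]

theorem X_mul_X_mem_crystalInitialIdeal {i j : Fin k} (h : i ≠ j) (a : Fin (n i)) (b : Fin (n j)) :
    X (x i a) * X (x j b) ∈ crystalInitialIdeal K n := by
  have key := monomial_mem_initialIdeal (K := K) (r := varLT)
    (I := joinMeetIdeal K (CrystalLattice n))
    (α := Finsupp.single (x i a) 1 + Finsupp.single (x j b) 1)
    (β := Finsupp.single t 1 + Finsupp.single s 1) ?_ ?_ ?_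
  · simpa only [monomial_add_single, X, monomial_mul, one_mul] using! key
  · simpa only [X, monomial_mul, one_mul] using! X_mul_X_sub_mem_joinMeetIdeal (K := K) h a b
  · intro h
    simpa using DFunLike.congr_fun h s
  -- The other monomial `t s` contains the smallest variable `s`, hence is smaller in the reverse
  -- lexicographic order.
  · refine .inr ⟨by simp, s, by simp, fun u hu ↦ ?_⟩
    cases u <;> exact hu.elim

theorem exists_val_ne_zero_and_ne (hk : 2 < k) (i : Fin k) : ∃ j : Fin k, j.val ≠ 0 ∧ j ≠ i := by
  by_cases h : i = ⟨1, by omega⟩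
  · exact ⟨⟨2, by omega⟩, by simp, by simp [h]⟩
  · exact ⟨⟨1, by omega⟩, by simp, fun h' ↦ h h'.symm⟩

/-- For `y` on a third chain, `y x_j - t s` and `y x₀ - t s` lie in the ideal; eliminating `y` gives
`t s x_j - t s x₀`. With `x₀` the smallest variable after `s`, the initial monomial is the one with
`x_j`, which is why `j` is not the first chain. -/
theorem X_mul_X_mul_X_mem_crystalInitialIdeal (hk : 2 < k) {j : Fin k} (hj : j.val ≠ 0)
    (hn : ∀ i, 1 ≤ n i) (b : Fin (n j)) :
    X t * X s * X (x j b) ∈ crystalInitialIdeal K n := by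
  obtain ⟨l, hl0, hlj⟩ : ∃ l : Fin k, l.val ≠ 0 ∧ l ≠ j := exists_val_ne_zero_and_ne hk j
  have hk0 : 0 < k := by omega
  let x₀ : CrystalLattice n := x ⟨0, hk0⟩ ⟨0, hn _⟩
  let y : CrystalLattice n := x l ⟨0, hn _⟩
  have hmem : X t * X s * X (x j b) - X t * X s * X x₀ ∈ joinMeetIdeal K (CrystalLattice n) := by
    have h₁ : X y * X (x j b) - X t * X s ∈ joinMeetIdeal K (CrystalLattice n) :=
      X_mul_X_sub_mem_joinMeetIdeal hlj _ _
    have h₂ : X y * X x₀ - X t * X s ∈ joinMeetIdeal K (CrystalLattice n) :=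
      X_mul_X_sub_mem_joinMeetIdeal (fun h ↦ hl0 (congrArg Fin.val h)) _ _
    convert sub_mem (Ideal.mul_mem_left _ (X x₀) h₁) (Ideal.mul_mem_left _ (X (x j b)) h₂) using 1
    ring
  have hne : x j b ≠ x₀ := fun h ↦ hj (congrArg Fin.val (by injection h : j = ⟨0, hk0⟩))
  have key := monomial_mem_initialIdeal (K := K) (r := varLT)
    (I := joinMeetIdeal K (CrystalLattice n))
    (α := Finsupp.single t 1 + Finsupp.single s 1 + Finsupp.single (x j b) 1)
    (β := Finsupp.single t 1 + Finsupp.single s 1 + Finsupp.single x₀ 1) ?_ ?_ ?_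
  · simpa only [X, monomial_mul, one_mul] using! key
  · simpa only [X, monomial_mul, one_mul] using! hmem
  · intro h
    have := DFunLike.congr_fun h x₀
    simp [hne, x₀] at this
  · refine .inr ⟨by simp, x₀, by simp [Finsupp.single_eq_of_ne' hne], fun u hu ↦ ?_⟩
    cases u with
    | s => simp [x₀]
    | t => exact hu.elim
    | x i a =>
      rcases hu with hu | ⟨rfl, hu⟩
      · exact absurd hu (by simp [Fin.lt_def])
      · exact absurd hu (by simp)

/-! ### The prime attached to a chain and the final bounds -/

/-- The elements of the crystal lattice other than `t` that do not lie on the `j`-th chain. -/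
noncomputable def offChain (j : Fin k) : Finset (CrystalLattice n) :=
  Finset.univ.filter fun v ↦ v ≠ t ∧ ∀ a, v ≠ x j a

theorem s_mem_offChain {j : Fin k} : (s : CrystalLattice n) ∈ offChain j := by
  simp [offChain]

theorem x_mem_offChain {i j : Fin k} (h : i ≠ j) (a : Fin (n i)) : x i a ∈ offChain j := by
  simp only [offChain, Finset.mem_filter, Finset.mem_univ, true_and]
  exact ⟨by simp, fun b hb ↦ h (by injection hb)⟩

theorem card_le_card_offChain {i j : Fin k} (h : i ≠ j) :
    n i ≤ (offChain (n := n) j).card := by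
  have : (Finset.univ.image (x (n := n) i)).card = n i := by
    rw [Finset.card_image_of_injective _ fun a b hab ↦ by injection hab, Finset.card_fin]
  rw [← this]
  refine Finset.card_le_card fun v hv ↦ ?_
  obtain ⟨a, -, rfl⟩ := Finset.mem_image.mp hv
  exact x_mem_offChain h a

theorem joinMeetIdeal_le_variableIdeal_offChain (j : Fin k) :
    joinMeetIdeal K (CrystalLattice n) ≤
      variableIdeal K (offChain (n := n) j : Set (CrystalLattice n)) := by
  have hX {v : CrystalLattice n} (hv : v ∈ offChain j) :
      X v ∈ variableIdeal K (offChain (n := n) j : Set (CrystalLattice n)) :=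
    Ideal.subset_span ⟨v, hv, rfl⟩
  refine Ideal.span_le.mpr ?_
  rintro _ ⟨a, b, rfl⟩
  by_cases hab : a ≤ b
  · rw [sup_eq_right.mpr hab, inf_eq_left.mpr hab, mul_comm, sub_self]
    exact zero_mem _
  by_cases hba : b ≤ a
  · rw [sup_eq_left.mpr hba, inf_eq_right.mpr hba, sub_self]
    exact zero_mem _
  cases a with
  | s => exact absurd (s_le _) hab
  | t => exact absurd (le_t _) hba
  | x i a =>
    cases b with
    | s => exact absurd (s_le _) hba
    | t => exact absurd (le_t _) hab
    | x i' b =>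
      have hii' : i ≠ i' := by
        rintro rfl
        rcases le_total a.val b.val with h | h
        · exact hab ⟨rfl, h⟩
        · exact hba ⟨rfl, h⟩
      have h₁ : x i a ⊔ x i' b = t := if_neg hii'
      have h₂ : x i a ⊓ x i' b = s := if_neg hii'
      rw [h₁, h₂]
      refine sub_mem ?_ (Ideal.mul_mem_left _ _ (hX s_mem_offChain))
      by_cases h : i = j
      · exact Ideal.mul_mem_left _ _ (hX (x_mem_offChain (h ▸ hii'.symm) b))
      · exact Ideal.mul_mem_right _ _ (hX (x_mem_offChain h a))

/-- On generators: `s` uses the cubic initial monomial, a variable of another chain the quadratic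
one. Hence `t x` annihilates the kernel of `R/J → R/P`. -/
theorem mul_mem_crystalInitialIdeal (hk : 2 < k) {j : Fin k} (hj : j.val ≠ 0)
    (hn : ∀ i, 1 ≤ n i) (b : Fin (n j)) {p : MvPolynomial (CrystalLattice n) K}
    (hp : p ∈ variableIdeal K (offChain (n := n) j : Set (CrystalLattice n))) :
    X t * X (x j b) * p ∈ crystalInitialIdeal K n := by
  refine Submodule.span_induction (fun _ ⟨v, hv, hvp⟩ ↦ ?_) ?_ (fun p q _ _ hp hq ↦ ?_)
    (fun r p _ hp ↦ ?_) hp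
  · rw [← hvp]
    simp only [Finset.mem_coe, offChain, Finset.mem_filter, Finset.mem_univ, true_and] at hv
    cases v with
    | s =>
      rw [mul_right_comm]
      exact X_mul_X_mul_X_mem_crystalInitialIdeal hk hj hn b
    | t => exact absurd rfl hv.1
    | x i a =>
      have hji : j ≠ i := by
        rintro rfl
        exact hv.2 a rfl
      rw [mul_assoc]
      exact Ideal.mul_mem_left _ _ (X_mul_X_mem_crystalInitialIdeal hji b a)
  · rw [mul_zero]
    exact zero_mem _
  · rw [mul_add]
    exact add_mem hp hq
  · rw [smul_eq_mul, mul_left_comm]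
    exact Ideal.mul_mem_left _ _ hp

theorem crystalInitialIdeal_le_variableIdeal_offChain (j : Fin k) :
    crystalInitialIdeal K n ≤ variableIdeal K (offChain (n := n) j : Set (CrystalLattice n)) :=
  initialIdeal_le_variableIdeal _ (joinMeetIdeal_le_variableIdeal_offChain j)

/-- The maximal ideal of the point whose coordinates at `t` and on the `j`-th chain are `1` and
whose other coordinates are `0`. -/
noncomputable def chainPointIdeal (K : Type u) [Field K] (n : Fin k → ℕ) (j : Fin k) :
    Ideal (MvPolynomial (CrystalLattice n) K) :=
  RingHom.ker (eval fun v ↦ if v ∈ offChain (n := n) j then (0 : K) else 1)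

instance (j : Fin k) : (chainPointIdeal K n j).IsMaximal :=
  RingHom.ker_isMaximal_of_surjective _ fun c ↦ ⟨C c, eval_C c⟩

theorem length_quotient_chainPointIdeal (j : Fin k) :
    Module.length (MvPolynomial (CrystalLattice n) K)
      (MvPolynomial (CrystalLattice n) K ⧸ chainPointIdeal K n j) = 1 :=
  have : IsSimpleModule (MvPolynomial (CrystalLattice n) K)
      (MvPolynomial (CrystalLattice n) K ⧸ chainPointIdeal K n j) :=
    isSimpleModule_iff_isCoatom.mpr (Ideal.isMaximal_def.mp inferInstance)
  Module.length_eq_one _ _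

/-- The element `t x` kills `P/J` but acts as `1` on the residue field, so Ext of `R/P` embeds in
Ext of `R/J`; the generators of `P` include all of chain `i`. -/
theorem choose_le_extLength_crystal (hk : 2 < k) (hn : ∀ i, 1 ≤ n i) {i j : Fin k} (hij : i ≠ j)
    (hj : j.val ≠ 0) (l : ℕ) :
    ((n i).choose l : ℕ∞) ≤ extLength (MvPolynomial (CrystalLattice n) K)
      (MvPolynomial (CrystalLattice n) K ⧸ crystalInitialIdeal K n)
      (MvPolynomial (CrystalLattice n) K ⧸ chainPointIdeal K n j) l := by
  let b : Fin (n j) := ⟨0, hn j⟩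
  have hsmul (q p : MvPolynomial (CrystalLattice n) K) :
      q • Ideal.Quotient.mk (chainPointIdeal K n j) p = Ideal.Quotient.mk _ (q * p) := rfl
  refine le_trans (Nat.cast_le.mpr (Nat.choose_le_choose l (card_le_card_offChain hij)))
    ((choose_le_extLength (offChain j) (fun v hv y ↦ ?_) l).trans
      (extLength_le_of_extLength_eq_zero
        (g := Submodule.factor (crystalInitialIdeal_le_variableIdeal_offChain (K := K) j))
        (Submodule.subtype_injective _) (Submodule.factor_surjective _)
        (LinearMap.exact_subtype_ker_map _)
        (extLength_eq_zero (r := X t * X (x j b)) (fun y ↦ ?_) (fun y ↦ ?_)) l))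
  · obtain ⟨p, rfl⟩ := Ideal.Quotient.mk_surjective y
    rw [hsmul, Ideal.Quotient.eq_zero_iff_mem]
    exact Ideal.mul_mem_right _ _ (by simp [chainPointIdeal, RingHom.mem_ker, hv])
  · obtain ⟨y, hy⟩ := y
    obtain ⟨p, rfl⟩ := Submodule.mkQ_surjective _ y
    rw [LinearMap.mem_ker, Submodule.factor_mk, Submodule.mkQ_apply,
      Submodule.Quotient.mk_eq_zero] at hy
    refine Subtype.ext ?_
    exact (Submodule.Quotient.mk_eq_zero _).mpr (mul_mem_crystalInitialIdeal hk hj hn b hy)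
  · obtain ⟨p, rfl⟩ := Ideal.Quotient.mk_surjective y
    rw [hsmul, Ideal.Quotient.mk_eq_mk_iff_sub_mem]
    have ht : (t : CrystalLattice n) ∉ offChain j := by simp [offChain]
    have hx : x j b ∉ offChain j := by simp [offChain]
    simp [chainPointIdeal, RingHom.mem_ker, ht, hx]

theorem corollary1 {K : Type*} [Field K] (k : ℕ) (hk : 2 < k) (n : Fin k → ℕ)
    (hn : ∀ i, 1 ≤ n i) :
    (((Finset.univ.sup n : ℕ) : WithBot ℕ∞) ≤
        projectiveDimension (ModuleCat.of (MvPolynomial (CrystalLattice n) K)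
          (MvPolynomial (CrystalLattice n) K ⧸ crystalInitialIdeal K n)) ∧
      projectiveDimension (ModuleCat.of (MvPolynomial (CrystalLattice n) K)
          (MvPolynomial (CrystalLattice n) K ⧸ crystalInitialIdeal K n)) ≤
        ((∑ i, n i + 2 : ℕ) : WithBot ℕ∞)) ∧
    Nonempty (MinimalGradedFreeResolution (crystalInitialIdeal K n)) ∧
    ∀ F : MinimalGradedFreeResolution (crystalInitialIdeal K n),
      ∀ i, 1 ≤ i → i ≤ n ⟨0, by omega⟩ →
        (n ⟨0, by omega⟩).choose i ≤ ∑ᶠ j : ℕ, F.gradedBetti i j := by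
  have hmono : crystalInitialIdeal K n = monomialIdeal K _ := initialIdeal_eq_monomialIdeal _ _
  refine ⟨⟨?_, ?_⟩, ?_, fun F i _ _ ↦ ?_⟩
  · obtain ⟨i, -, hi⟩ := Finset.exists_mem_eq_sup Finset.univ ⟨⟨0, by omega⟩, Finset.mem_univ _⟩ n
    obtain ⟨j, hj0, hij⟩ := exists_val_ne_zero_and_ne hk i
    rw [hi, projectiveDimension_ge_iff]
    intro hpd
    -- In degree `n i` the binomial coefficient is `1`, so this Ext is nonzero.
    have hle := choose_le_extLength_crystal (K := K) hk hn hij.symm hj0 (n i)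
    have hzero := HasProjectiveDimensionLT.subsingleton (ModuleCat.of (MvPolynomial _ K)
      (MvPolynomial (CrystalLattice n) K ⧸ crystalInitialIdeal K n)) (n i) (n i) le_rfl
        (ModuleCat.of (MvPolynomial (CrystalLattice n) K)
          (MvPolynomial (CrystalLattice n) K ⧸ chainPointIdeal K n j))
    rw [extLength, Module.length_eq_zero_iff.mpr hzero, Nat.choose_self] at hle
    simp at hle
  · rw [projectiveDimension_le_iff, ← card_crystalLattice, hmono]
    exact hasProjectiveDimensionLE_quotient_monomialIdeal _
  · refine nonempty_minimalGradedFreeResolution _ (fun p hp e ↦ ?_) fun p hp ↦ ?_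
    · rw [hmono] at hp ⊢
      exact homogeneousComponent_mem_monomialIdeal hp e
    · have := crystalInitialIdeal_le_variableIdeal_offChain ⟨0, by omega⟩ hp
      rw [constantCoeff_eq, ← notMem_support_iff]
      intro h0
      obtain ⟨v, -, hv⟩ := mem_ideal_span_X_image.mp this 0 h0
      exact hv rfl
  -- The second chain serves as `j`, so that `P` contains the first chain.
  · have h01 : (⟨0, by omega⟩ : Fin k) ≠ ⟨1, by omega⟩ := by simp
    rw [F.finsum_gradedBetti, ← Nat.cast_le (α := ℕ∞)]
    exact (choose_le_extLength_crystal hk hn h01 one_ne_zero i).trans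
      (extLength_le_rank (length_quotient_chainPointIdeal _) F.rank F.d F.aug F.aug_surjective
        F.exact_aug F.exact_d i)

end Crystal
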